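/- **Switch and traffic.** A $K\times N$ switch works in time slots. A *flow* is a pair $(i,J)$ of an input $i$ and a nonempty set $J$ of outputs; a *traffic pattern* is a (finite) set of flows, and its *subflows* are the triples $(i,J,j)$ with $(i,J)$ a flow of the pattern and $j\in J$. A rate vector $\mathbf r=(r_{iJ})\ge 0$ is *admissible* if for every input the rates of the flows from that input add up to at most $1$, and for every output $j$ the rates of the flows with $j\in J$ add up to at most $1$. Let $\mathbf A$ be the set of admissible rate vectors. **Enhanced conflict graph.** The enhanced conflict graph $G$ of the pattern has the subflows as vertices; distinct subflows $(i,J,j)$ and $(i',J',j')$ are adjacent if and only if $j=j'$, or $i=i'$ and $J\ne J'$. **Imperfection ratio.** $STAB(G)$ is the convex hull of the incidence vectors of the stable sets of $G$; $QSTAB(G)$ is the set of all $x\ge 0$ with $\sum_{v\in Q}x_v\le 1$ for every clique $Q$ of $G$; and $\mathrm{imp}(G)=\min\{t\ge 0: QSTAB(G)\subseteq t\,STAB(G)\}$. **Achievability.** In a configuration of the switch every input sends at most one packet, every output receives from at most one input, and several outputs may receive the same packet. The packet sent is a linear combination, over a finite field, of packets of one flow that arrived at this input in earlier slots. With speedup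 $s\ge 0$ the switch goes through $\lfloor st\rfloor$ configurations in the first $t$ slots, for every $t$. A scheduling and coding scheme chooses the configurations and the coefficients, depending on the arrivals in earlier slots. The virtual queue of a subflow $(i,J,j)$ is the number of packets of $(i,J)$ that have arrived, minus the dimension of the span of the coefficient vectors of the packets of $(i,J)$ that output $j$ has received. Let $a_{iJ}(t)$ be the number of packets of flow $(i,J)$ that arrive in slot $t$, and $H(t)$ the history of all arrivals before slot $t$. An arrival process has rate vector $\mathbf r$ if, for every flow, $\frac1t\sum_{\tau<t}E[a_{iJ}(\tau)]\to r_{iJ}$; there is $A_{\max}$ with $E[a_{iJ}(t)^2\mid H(t)]\le A_{\max}^2$ for all $t$; and for every $\delta>0$ there is $T\geq 1$ with $E[\frac1T\sum_{k<T}a_{iJ}(t_0+k)\mid H(t_0)]\le r_{iJ}+\delta$ for all $t_0$. The rate vector $\mathbf r\ge 0$ is *achievable with speedup $s$* if there are a finite field and a scheduling and coding scheme such that, for every arrival process with rate vector $\mathbf r$, every virtual queue $U$ is strongly stable: $\limsup_{t\to\infty}\frac1t\sum_{\tau<t}E[U(\tau)]<\infty$. Let $\mathbf R$ be the set of rate vectors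 that are achievable with speedup $1$. **Theorem.** For every traffic pattern, with enhanced conflict graph $G$, the minimum in the definition of $\mathrm{imp}(G)$ is attained. Let $$s_{\min}=\inf\{s\ge 0:\text{ every }\mathbf r\in\mathbf A\text{ is achievable with speedup }s\}.$$ This set is nonempty, and $$s_{\min}\le \mathrm{imp}(G).$$ Likewise $\{s\ge 0:\mathbf A\subseteq s\,\mathbf R\}$ is nonempty and $\inf\{s\ge 0:\mathbf A\subseteq s\,\mathbf R\}\le \mathrm{imp}(G)$; moreover $\mathbf A\subseteq \mathrm{imp}(G)\,\overline{\mathbf R}$, where $\overline{\mathbf R}$ is the closure of $\mathbf R$. -/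

import Mathlib

open MeasureTheory Filter Topology
open scoped Pointwise ENNReal

noncomputable section

namespace MulticastSwitch

/-! ### Graph polytopes -/

section Graph

variable {V : Type*}

/-- The stable set polytope `STAB(G)`: the convex hull of the incidence vectors of stable sets. -/
def STAB (G : SimpleGraph V) : Set (V → ℝ) :=
  convexHull ℝ {x | ∃ S : Set V, G.IsIndepSet S ∧ x = S.indicator (fun _ => (1 : ℝ))}

/-- The fractional stable set polytope `QSTAB(G)`: nonnegative vectors that satisfy all clique
inequalities. -/
def QSTAB (G : SimpleGraph V) : Set (V → ℝ) :=
  {x | (∀ v, 0 ≤ x v) ∧ ∀ Q : Finset V, G.IsClique (Q : Set V) → ∑ v ∈ Q, x v ≤ 1}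

/-- The dilations `t ≥ 0` with `QSTAB(G) ⊆ t STAB(G)`. -/
def imperfectionDilations (G : SimpleGraph V) : Set ℝ :=
  {t | 0 ≤ t ∧ QSTAB G ⊆ t • STAB G}

/-- The imperfection ratio `imp(G) = min {t : QSTAB(G) ⊆ t STAB(G)}`. -/
def imperfectionRatio (G : SimpleGraph V) : ℝ := sInf (imperfectionDilations G)

end Graph

/-! ### Traffic patterns and the enhanced conflict graph -/

/-- A traffic pattern of a `K × N` switch: a set of flows `(i, J)`, where `i` is an input and `J` is
a nonempty set of outputs, the fanout set. -/
structure TrafficPattern (K N : ℕ) where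
  flows : Finset (Fin K × Finset (Fin N))
  fanout_nonempty : ∀ f ∈ flows, f.2.Nonempty

namespace TrafficPattern

variable {K N : ℕ} (P : TrafficPattern K N)

/-- The flows of the pattern. -/
abbrev Flow : Type := {f : Fin K × Finset (Fin N) // f ∈ P.flows}

variable {P} in
/-- The input `i` of the flow `(i, J)`. -/
def Flow.input (f : P.Flow) : Fin K := f.1.1

variable {P} in
/-- The fanout set `J` of the flow `(i, J)`. -/
def Flow.fanout (f : P.Flow) : Finset (Fin N) := f.1.2

/-- The subflows `(i, J, j)`, `j ∈ J`, of the pattern. -/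
abbrev Subflow : Type := (f : P.Flow) × {j : Fin N // j ∈ f.fanout}

/-- The enhanced conflict graph: distinct subflows `(i, J, j)` and `(i', J', j')` are adjacent iff
`j = j'`, or `i = i'` and `J ≠ J'`. -/
def enhancedConflictGraph : SimpleGraph P.Subflow where
  Adj u v := u ≠ v ∧
    (u.2.1 = v.2.1 ∨ (u.1.input = v.1.input ∧ u.1.fanout ≠ v.1.fanout))
  symm := ⟨fun _ _ h => ⟨h.1.symm, h.2.imp Eq.symm (fun g => ⟨g.1.symm, g.2.symm⟩)⟩⟩
  loopless := ⟨fun _ h => h.1 rfl⟩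

/-- The admissible rate region `A`: nonnegative rate vectors for which no input and no output is
oversubscribed. -/
def admissibleRegion : Set (P.Flow → ℝ) :=
  {r | (∀ f, 0 ≤ r f) ∧
    (∀ i : Fin K, ∑ f : P.Flow with f.input = i, r f ≤ 1) ∧
    (∀ j : Fin N, ∑ f : P.Flow with j ∈ f.fanout, r f ≤ 1)}

/-! ### Switch configurations, schedules and intra-flow linear codes -/

/-- A switch configuration together with the coded packets that are sent. Every input sends at most
one packet, which is a linear combination of packets of one of its own flows; it is given by the flow
and its coefficient vector (the `m`-th coordinate is the coefficient of the `m`-th packet of the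
flow). Every output is connected to at most one input; several outputs may be connected to the same
input, and then they all receive the same packet. -/
structure Config (F : Type) [Field F] where
  packet : Fin K → Option (P.Flow × (ℕ →₀ F))
  packet_input : ∀ i f v, packet i = some (f, v) → f.input = i
  source : Fin N → Option (Fin K)

variable {P} in
/-- In configuration `c`, output `j` receives the packet of flow `f` with coefficient vector `v`. -/
def Config.Delivers {F : Type} [Field F] (c : P.Config F) (j : Fin N) (f : P.Flow) (v : ℕ →₀ F) :
    Prop :=
  ∃ i, c.source j = some i ∧ c.packet i = some (f, v)

/-- The knowledge space of an input with respect to one of its flows, when `n` packets of the flow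
have arrived: all linear combinations of these packets. -/
def inputKnowledge (F : Type) [Field F] (n : ℕ) : Submodule F (ℕ →₀ F) :=
  Submodule.span F {v | ∃ m < n, v = Finsupp.single m 1}

/-- A scheduling and coding scheme. For every slot `t`, every history `h` of arrivals in the slots
before `t` (`h u f` packets of flow `f` have arrived in slot `u`) and every `k`, it specifies the
`k`-th configuration that is used in slot `t`. Arrivals may occur any time during a slot and
transmissions begin at the beginning of a slot, so that only packets which have arrived in earlier
slots can be combined. -/
structure Scheme (F : Type) [Field F] where
  config : (t : ℕ) → (Fin t → P.Flow → ℕ) → ℕ → P.Config F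
  causal : ∀ t h k i f v, (config t h k).packet i = some (f, v) →
    v ∈ inputKnowledge F (∑ u, h u f)

/-- The number of configurations that a switching fabric of speedup `s` goes through in slot `t`:
it goes through `⌊s t⌋` configurations in the first `t` slots. For `s = 1` this is one configuration
in every slot. -/
def configsInSlot (s : ℝ) (t : ℕ) : ℕ := ⌊s * (t + 1 : ℕ)⌋₊ - ⌊s * t⌋₊

variable {P} in
/-- The knowledge space of output `j` with respect to flow `f` at the beginning of slot `t`, where
`a u g` is the number of packets of flow `g` that arrive in slot `u`, and the speedup is `s`: the
span of the coefficient vectors of all packets of `f` that `j` has received. -/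
def Scheme.outputKnowledge {F : Type} [Field F] (π : P.Scheme F) (s : ℝ) (a : ℕ → P.Flow → ℕ)
    (f : P.Flow) (j : Fin N) (t : ℕ) : Submodule F (ℕ →₀ F) :=
  Submodule.span F {v | ∃ u < t, ∃ k < configsInSlot s u,
    (π.config u (fun w : Fin u => a w) k).Delivers j f v}

variable {P} in
/-- The size of the virtual queue of a subflow at the beginning of slot `t`: the dimension of the
knowledge space of the input minus that of the output. (The latter is a subspace of the former, so
that the difference is never truncated.) -/
def Scheme.virtualQueue {F : Type} [Field F] (π : P.Scheme F) (s : ℝ) (a : ℕ → P.Flow → ℕ)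
    (w : P.Subflow) (t : ℕ) : ℕ :=
  Module.finrank F (inputKnowledge F (∑ u ∈ Finset.range t, a u w.1)) -
    Module.finrank F (π.outputKnowledge s a w.1 w.2.1 t)

/-! ### Arrival processes, strong stability and achievability -/

variable {P} in
/-- The history up to slot `t`: the σ-algebra generated by all arrivals in the slots before `t`. -/
abbrev history {Ω : Type} (a : ℕ → P.Flow → Ω → ℕ) (t : ℕ) : MeasurableSpace Ω :=
  ⨆ u : Fin t, ⨆ f : P.Flow, MeasurableSpace.comap (a u f) ⊤

/-- The arrival processes with rate vector `r`; `a t f` packets of flow `f` arrive in slot `t`. The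
average expected number of arrivals converges to the rate, second moments conditioned on the history
are bounded, and the average number of arrivals over a suitable window exceeds the rate by at most
`δ` in expectation, whatever the history is. -/
structure IsArrivalStream {Ω : Type} [MeasurableSpace Ω] (μ : Measure Ω)
    (a : ℕ → P.Flow → Ω → ℕ) (r : P.Flow → ℝ) : Prop where
  measurable : ∀ t f, Measurable (a t f)
  sq_integrable : ∀ t f, Integrable (fun ω => (a t f ω : ℝ) ^ 2) μ
  rate : ∀ f, Tendsto (fun t : ℕ => (∑ u ∈ Finset.range t, ∫ ω, (a u f ω : ℝ) ∂μ) / t)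
    atTop (𝓝 (r f))
  second_moment : ∀ f, ∃ Amax : ℝ, ∀ t,
    μ[fun ω => (a t f ω : ℝ) ^ 2 | history a t] ≤ᵐ[μ] fun _ => Amax ^ 2
  window : ∀ f, ∀ δ > 0, ∃ T : ℕ, 0 < T ∧ ∀ t₀,
    μ[fun ω => (∑ k ∈ Finset.range T, (a (t₀ + k) f ω : ℝ)) / T | history a t₀]
      ≤ᵐ[μ] fun _ => r f + δ

/-- A queue is strongly stable if its time average expected backlog is finite:
`limsup (1/t) ∑_{u < t} E[U(u)] < ∞`. -/
def StronglyStable {Ω : Type} [MeasurableSpace Ω] (μ : Measure Ω) (U : ℕ → Ω → ℕ) : Prop :=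
  limsup (fun t : ℕ => (∑ u ∈ Finset.range t, ∫⁻ ω, (U u ω : ℝ≥0∞) ∂μ) / t) atTop < ∞

/-- The rate vector `r` is achievable with speedup `s` (with fanout splitting and intra-flow linear
network coding): there are a finite field and a scheduling and coding scheme over it that keep all
virtual queues strongly stable, for every arrival process with rate vector `r`. -/
def AchievableWithSpeedup (s : ℝ) (r : P.Flow → ℝ) : Prop :=
  (∀ f, 0 ≤ r f) ∧
  ∃ (F : Type) (_ : Field F) (_ : Finite F) (π : P.Scheme F),
    ∀ (Ω : Type) (_ : MeasurableSpace Ω) (μ : Measure Ω) (_ : IsProbabilityMeasure μ)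
      (a : ℕ → P.Flow → Ω → ℕ), P.IsArrivalStream μ a r →
      ∀ w : P.Subflow,
        StronglyStable μ (fun t ω => π.virtualQueue s (fun u f => a u f ω) w t)

/-- The rate region `R`: the rate vectors that are achievable without speedup. -/
def rateRegion : Set (P.Flow → ℝ) := {r | P.AchievableWithSpeedup 1 r}

/-- The speedups with which every admissible rate vector is achievable. -/
def sufficientSpeedups : Set ℝ :=
  {s | 0 ≤ s ∧ ∀ r ∈ P.admissibleRegion, P.AchievableWithSpeedup s r}

/-- The minimum speedup `s_min` needed to achieve all admissible rates. -/
def minSpeedup : ℝ := sInf P.sufficientSpeedups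

/-- The factors `s` with `A ⊆ s R`. -/
def sufficientScalings : Set ℝ :=
  {s | 0 ≤ s ∧ P.admissibleRegion ⊆ s • P.rateRegion}

/-- The minimum speedup in the form `min {s : A ⊆ s R}`. -/
def minScaling : ℝ := sInf P.sufficientScalings

end TrafficPattern

end MulticastSwitch

end

/-!
The upper bound rests on the fact that one switch configuration can serve a whole stable set of the
enhanced conflict graph: its subflows go to different outputs, and those from one input belong to one
flow, so that a single coded packet per input serves them all (`delivers_serve`). On the other hand, a
clique consists of subflows to one output or of subflows of distinct flows from one input, so
that an admissible rate vector, spread over the subflows, satisfies all clique inequalities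
(`rate_mem_QSTAB`). By the definition of the imperfection ratio, such a vector lies in
`imp(G) STAB(G)`; hence, with a speedup above `imp(G)`, a periodic sequence of stable sets offers
every subflow more service than its rate (`exists_mem_STAB_lt`, `exists_periodic_schedule`).

Every offered service must also be useful. Over a field with more elements than there are outputs,
an input can send a packet that is new to all outputs of the flow which still miss something, since the
knowledge space of the input is not the union of so few proper subspaces
(`exists_isInnovative`). Then each offered service takes one packet off the virtual queue if it is not
empty (`virtualQueue_succ_le`), and the queues behave as ordinary queues with more service than
arrivals. The expected square of such a queue has negative drift over long windows, which gives strong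
stability (`stronglyStable_of_service`).

Scaling the rates instead of the speedup gives the statements about the rate region, and the closure
comes in when the scaling factor tends to the imperfection ratio. The minimum that defines this ratio
is attained because `STAB(G)` is compact.
-/

namespace MulticastSwitch

/-! ### The stable set polytopes and the imperfection ratio -/

section Polytope

variable {V : Type*} {G : SimpleGraph V}

theorem indicator_mem_STAB {S : Set V} (hS : G.IsIndepSet S) :
    S.indicator (fun _ => (1 : ℝ)) ∈ STAB G :=
  subset_convexHull ℝ _ ⟨S, hS, rfl⟩

theorem zero_mem_STAB (G : SimpleGraph V) : (0 : V → ℝ) ∈ STAB G := by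
  have h := indicator_mem_STAB (G := G) (S := ∅) (by simp [SimpleGraph.IsIndepSet])
  rwa [Set.indicator_empty] at h

theorem single_mem_STAB [DecidableEq V] (G : SimpleGraph V) (v : V) :
    (Pi.single v 1 : V → ℝ) ∈ STAB G := by
  have h := indicator_mem_STAB (G := G) (S := {v}) (by simp [SimpleGraph.IsIndepSet])
  convert h using 1
  ext w
  by_cases hw : w = v
  · subst hw; simp
  · simp [hw]

theorem convex_STAB (G : SimpleGraph V) : Convex ℝ (STAB G) := convex_convexHull ℝ _

theorem isCompact_STAB [Finite V] (G : SimpleGraph V) : IsCompact (STAB G) := by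
  have hfin : {x | ∃ S : Set V, G.IsIndepSet S ∧ x = S.indicator (fun _ => (1 : ℝ))}.Finite := by
    refine (Set.finite_range (fun S : Set V => S.indicator (fun _ => (1 : ℝ)))).subset ?_
    rintro x ⟨S, -, rfl⟩
    exact ⟨S, rfl⟩
  exact hfin.isCompact_convexHull (𝕜 := ℝ)

theorem le_one_of_mem_QSTAB {x : V → ℝ} (hx : x ∈ QSTAB G) (v : V) : x v ≤ 1 := by
  simpa using hx.2 {v} (by simp)

/-- Averaging the incidence vectors of the vertices gives a point of `STAB(G)` in the open positive
orthant. -/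
theorem exists_pos_mem_STAB [Finite V] (G : SimpleGraph V) : ∃ u ∈ STAB G, ∀ v, 0 < u v := by
  classical
  have := Fintype.ofFinite V
  cases isEmpty_or_nonempty V with
  | inl h => exact ⟨0, zero_mem_STAB G, fun v => h.elim v⟩
  | inr h =>
    have hc : (0 : ℝ) < Fintype.card V := by exact_mod_cast Fintype.card_pos
    refine ⟨∑ v, (Fintype.card V : ℝ)⁻¹ • Pi.single v 1, ?_, fun v => ?_⟩
    · refine (convex_STAB G).sum_mem (fun _ _ => by positivity) ?_
        (fun v _ => single_mem_STAB G v)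
      simp [hc.ne']
    · simp only [Finset.sum_apply, Pi.smul_apply, Pi.single_apply, smul_eq_mul, mul_ite, mul_one,
        mul_zero, Finset.sum_ite_eq, Finset.mem_univ, if_true]
      positivity

/-- `QSTAB(G)` is contained in the unit cube, which is contained in `|V| STAB(G)`. -/
theorem imperfectionDilations_nonempty [Finite V] (G : SimpleGraph V) :
    (imperfectionDilations G).Nonempty := by
  classical
  have := Fintype.ofFinite V
  cases isEmpty_or_nonempty V with
  | inl h =>
    refine ⟨1, zero_le_one, fun x _ => ?_⟩
    rw [one_smul, Subsingleton.elim x 0]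
    exact zero_mem_STAB G
  | inr h =>
    have hc : (0 : ℝ) < Fintype.card V := by exact_mod_cast Fintype.card_pos
    refine ⟨Fintype.card V, hc.le, fun x hx => ?_⟩
    refine ⟨∑ v, (Fintype.card V : ℝ)⁻¹ • (x v • Pi.single v 1), ?_, ?_⟩
    · refine (convex_STAB G).sum_mem (fun _ _ => by positivity) (by simp [hc.ne'])
        (fun v _ => ?_)
      exact (convex_STAB G).smul_mem_of_zero_mem (zero_mem_STAB G) (single_mem_STAB G v)
        ⟨hx.1 v, le_one_of_mem_QSTAB hx v⟩
    · ext w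
      simp [Finset.sum_apply, Pi.single_apply, hc.ne']

theorem bddBelow_imperfectionDilations (G : SimpleGraph V) :
    BddBelow (imperfectionDilations G) := ⟨0, fun _ ht => ht.1⟩

theorem imperfectionRatio_nonneg (G : SimpleGraph V) : 0 ≤ imperfectionRatio G :=
  Real.sInf_nonneg fun _ ht => ht.1

/-- The dilations form a closed set, by compactness of `STAB(G)`. -/
theorem isClosed_imperfectionDilations [Finite V] (G : SimpleGraph V) :
    IsClosed (imperfectionDilations G) := by
  refine IsSeqClosed.isClosed fun t l ht hl => ⟨ge_of_tendsto' hl fun n => (ht n).1, fun x hx => ?_⟩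
  choose y hy hyx using fun n => (ht n).2 hx
  obtain ⟨z, hz, φ, hφ, hlim⟩ := (isCompact_STAB G).tendsto_subseq hy
  refine ⟨z, hz, ?_⟩
  refine tendsto_nhds_unique ((hl.comp hφ.tendsto_atTop).smul hlim) ?_
  exact tendsto_const_nhds.congr fun n => (hyx (φ n)).symm

theorem isLeast_imperfectionRatio [Finite V] (G : SimpleGraph V) :
    IsLeast (imperfectionDilations G) (imperfectionRatio G) :=
  (isClosed_imperfectionDilations G).isLeast_csInf (imperfectionDilations_nonempty G)
    (bddBelow_imperfectionDilations G)

/-- A speedup above `c · imp(G)` leaves room to serve every vertex strictly faster than `c x`, for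
`x` in `QSTAB(G)`: the spare time is spent on a positive point of `STAB(G)`. -/
theorem exists_mem_STAB_lt [Finite V] {x : V → ℝ} (hx : x ∈ QSTAB G) {c s : ℝ} (hc : 0 ≤ c)
    (hs : c * imperfectionRatio G < s) : ∃ y ∈ STAB G, ∀ v, c * x v < s * y v := by
  have hs0 : 0 < s := lt_of_le_of_lt (mul_nonneg hc (imperfectionRatio_nonneg G)) hs
  obtain ⟨y₀, hy₀, rfl⟩ := (isLeast_imperfectionRatio G).1.2 hx
  obtain ⟨u, hu, hpos⟩ := exists_pos_mem_STAB G
  set θ := c * imperfectionRatio G / s with hθ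
  have hθ0 : 0 ≤ θ := div_nonneg (mul_nonneg hc (imperfectionRatio_nonneg G)) hs0.le
  have hθ1 : θ < 1 := (div_lt_one hs0).2 hs
  have hsθ : s * θ = c * imperfectionRatio G := by rw [hθ]; field_simp
  refine ⟨θ • y₀ + (1 - θ) • u,
    convex_STAB G hy₀ hu hθ0 (sub_nonneg.2 hθ1.le) (by ring), fun v => ?_⟩
  have h1 : 0 < s * (1 - θ) * u v := mul_pos (mul_pos hs0 (sub_pos.2 hθ1)) (hpos v)
  simp only [Pi.smul_apply, Pi.add_apply, smul_eq_mul]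
  rw [show s * (θ * y₀ v + (1 - θ) * u v) = s * θ * y₀ v + s * (1 - θ) * u v by ring, hsθ]
  linarith

end Polytope

section Clique

variable {K N : ℕ} (P : TrafficPattern K N)

theorem TrafficPattern.flow_ext {P : TrafficPattern K N} {f g : P.Flow} (hi : f.input = g.input)
    (hJ : f.fanout = g.fanout) : f = g :=
  Subtype.ext (Prod.ext hi hJ)

theorem TrafficPattern.subflow_ext {P : TrafficPattern K N} {u v : P.Subflow} (hf : u.1 = v.1)
    (hj : u.2.1 = v.2.1) : u = v := by
  obtain ⟨f, j, hj⟩ := u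
  obtain ⟨g, k, hk⟩ := v
  obtain rfl : f = g := hf
  obtain rfl : j = k := hj
  rfl

/-- A clique of the enhanced conflict graph consists of subflows to one output, or of subflows of
distinct flows from one input. -/
theorem TrafficPattern.clique_cases {Q : Set P.Subflow} (hQ : P.enhancedConflictGraph.IsClique Q) :
    (∀ u ∈ Q, ∀ v ∈ Q, u.2.1 = v.2.1) ∨
      (∀ u ∈ Q, ∀ v ∈ Q, u.1.input = v.1.input ∧ (u.1 = v.1 → u = v)) := by
  by_cases h : ∀ u ∈ Q, ∀ v ∈ Q, u.2.1 = v.2.1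
  · exact Or.inl h
  right
  push Not at h
  obtain ⟨u, hu, v, hv, huv⟩ := h
  have adj : ∀ a ∈ Q, ∀ b ∈ Q, a.2.1 ≠ b.2.1 →
      a.1.input = b.1.input ∧ a.1.fanout ≠ b.1.fanout := fun a ha b hb hab =>
    (hQ ha hb (fun e => hab (by rw [e]))).2.resolve_left hab
  have key : ∀ w ∈ Q, w.1.input = u.1.input := by
    intro w hw
    by_cases h1 : w.2.1 = u.2.1
    · exact (adj w hw v hv (fun e => huv (h1.symm.trans e))).1.trans (adj u hu v hv huv).1.symm
    · exact (adj w hw u hu h1).1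
  refine fun a ha b hb => ⟨(key a ha).trans (key b hb).symm, fun hab => ?_⟩
  by_contra hne
  rcases (hQ ha hb hne).2 with h2 | h2
  · exact hne (subflow_ext hab h2)
  · exact h2.2 (by rw [hab])

/-- Giving every subflow the rate of its flow turns admissible rates into points of `QSTAB`: the
clique inequalities are the capacity constraints of the outputs and of the inputs. -/
theorem TrafficPattern.rate_mem_QSTAB {r : P.Flow → ℝ} (hr : r ∈ P.admissibleRegion) :
    (fun w : P.Subflow => r w.1) ∈ QSTAB P.enhancedConflictGraph := by
  classical
  refine ⟨fun w => hr.1 _, fun Q hQ => ?_⟩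
  obtain rfl | ⟨u, hu⟩ := Q.eq_empty_or_nonempty
  · simp
  have step : ∀ T : Finset P.Flow, (∀ w ∈ Q, w.1 ∈ T) →
      (∀ a ∈ Q, ∀ b ∈ Q, a.1 = b.1 → a = b) → ∑ w ∈ Q, r w.1 ≤ ∑ f ∈ T, r f := by
    intro T hT hinj
    rw [← Finset.sum_image (f := r) (g := Sigma.fst) (s := Q) (fun a ha b hb => hinj a ha b hb)]
    refine Finset.sum_le_sum_of_subset_of_nonneg ?_ fun f _ _ => hr.1 f
    intro f hf
    obtain ⟨w, hw, rfl⟩ := Finset.mem_image.1 hf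
    exact hT w hw
  rcases P.clique_cases hQ with h | h
  · refine (step _ (fun w hw => ?_) fun a ha b hb hab => ?_).trans (hr.2.2 u.2.1)
    · simp only [Finset.mem_filter, Finset.mem_univ, true_and]
      rw [← h w hw u hu]
      exact w.2.2
    · exact subflow_ext hab (h a ha b hb)
  · refine (step _ (fun w hw => ?_) fun a ha b hb => (h a ha b hb).2).trans (hr.2.1 u.1.input)
    simpa using (h w hw u hu).1

end Clique

/-! ### Periodic schedules of stable sets -/

section Schedule

theorem sum_range_add_eq_of_periodic {g : ℕ → ℕ} {L : ℕ} (hg : ∀ m, g (m + L) = g m) (m : ℕ) :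
    ∑ k ∈ Finset.range (m + L), g k = ∑ k ∈ Finset.range m, g k + ∑ k ∈ Finset.range L, g k := by
  induction m with
  | zero => simp
  | succ m ih =>
    rw [show m + 1 + L = m + L + 1 by ring, Finset.sum_range_succ, ih, hg, Finset.sum_range_succ]
    ring

theorem sum_range_add_mul_of_periodic {g : ℕ → ℕ} {L : ℕ} (hg : ∀ m, g (m + L) = g m) (m q : ℕ) :
    ∑ k ∈ Finset.range (m + q * L), g k =
      ∑ k ∈ Finset.range m, g k + q * ∑ k ∈ Finset.range L, g k := by
  induction q with
  | zero => simp
  | succ q ih =>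
    rw [show m + (q + 1) * L = m + q * L + L by ring, sum_range_add_eq_of_periodic hg, ih]
    ring

/-- If a point of `STAB(G)`, multiplied by `s`, exceeds `x`, then a periodic sequence of stable sets
used at rate `s` serves every vertex `v` at a rate above `x v`: each stable set gets a number of
places in the period that is about proportional to its weight in a convex combination. -/
theorem exists_periodic_schedule {V : Type*} [Finite V] {G : SimpleGraph V} {y x : V → ℝ} {s : ℝ}
    (hy : y ∈ STAB G) (hx : ∀ v, 0 ≤ x v) (hs : 0 ≤ s) (hxy : ∀ v, x v < s * y v) :
    ∃ (σ : ℕ → Set V) (L : ℕ), 0 < L ∧ (∀ m, G.IsIndepSet (σ m)) ∧ (∀ m, σ (m + L) = σ m) ∧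
      ∀ v, L * x v < s * (∑ m ∈ Finset.range L, (σ m).indicator (fun _ => 1) v : ℕ) := by
  classical
  have := Fintype.ofFinite V
  obtain ⟨ι, _, w, z, hw0, hw1, hz, rfl⟩ := mem_convexHull_iff_exists_fintype.1 hy
  choose S hS hzS using hz
  obtain rfl : z = fun i => (S i).indicator (fun _ => (1 : ℝ)) := funext hzS
  -- in the limit of long periods, rounding up the numbers of places costs nothing
  have hev : ∀ᶠ M : ℕ in atTop, 0 < M ∧ ∀ v, (M + Fintype.card ι) * x v <
      s * (M * (∑ i, w i • (S i).indicator (fun _ => (1 : ℝ))) v) := by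
    refine (eventually_gt_atTop 0).and (eventually_all.2 fun v => ?_)
    have h1 : Tendsto (fun M : ℕ => (M : ℝ) *
        (s * (∑ i, w i • (S i).indicator (fun _ => (1 : ℝ))) v - x v)) atTop atTop :=
      tendsto_natCast_atTop_atTop.atTop_mul_const (sub_pos.2 (hxy v))
    filter_upwards [h1.eventually_gt_atTop (Fintype.card ι * x v)] with M hM
    nlinarith
  obtain ⟨M, hM0, hM⟩ := hev.exists
  let n : ι → ℕ := fun i => ⌈M * w i⌉₊
  let E := Σ i, Fin (n i)
  let L := Fintype.card E
  have hLsum : L = ∑ i, n i := by simp [L, E]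
  have hLle : (L : ℝ) ≤ M + Fintype.card ι := by
    rw [hLsum, Nat.cast_sum]
    calc ∑ i, (n i : ℝ) ≤ ∑ i, (M * w i + 1) := Finset.sum_le_sum fun i _ =>
          (Nat.ceil_lt_add_one (mul_nonneg (Nat.cast_nonneg M) (hw0 i))).le
      _ = M + Fintype.card ι := by
          rw [Finset.sum_add_distrib, ← Finset.mul_sum, hw1]; simp
  have hLpos : 0 < L := by
    have h : (M : ℝ) ≤ L := by
      rw [hLsum, Nat.cast_sum]
      calc (M : ℝ) = ∑ i, M * w i := by rw [← Finset.mul_sum, hw1, mul_one]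
        _ ≤ _ := Finset.sum_le_sum fun i _ => Nat.le_ceil _
    exact hM0.trans_le (by exact_mod_cast h)
  let e : E ≃ Fin L := Fintype.equivFin E
  let σ : ℕ → Set V := fun m => S (e.symm ⟨m % L, Nat.mod_lt _ hLpos⟩).1
  refine ⟨σ, L, hLpos, fun m => hS _, fun m => ?_, fun v => ?_⟩
  · simp only [σ, Nat.add_mod_right]
  · have hcount : ∑ m ∈ Finset.range L, (σ m).indicator (fun _ => 1) v =
        ∑ i, n i * (S i).indicator (fun _ => 1) v := by
      calc ∑ m ∈ Finset.range L, (σ m).indicator (fun _ => 1) v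
          = ∑ m : Fin L, (S (e.symm m).1).indicator (fun _ => 1) v := by
            rw [Finset.sum_range]
            refine Finset.sum_congr rfl fun m _ => ?_
            simp only [σ, Nat.mod_eq_of_lt m.2]
        _ = ∑ p : E, (S p.1).indicator (fun _ => 1) v :=
            Equiv.sum_comp e.symm fun p : E => (S p.1).indicator (fun _ => 1) v
        _ = _ := by
            simp only [E, Fintype.sum_sigma, Finset.sum_const, Finset.card_univ, Fintype.card_fin,
              smul_eq_mul]
    rw [hcount]
    have hge : M * (∑ i, w i • (S i).indicator (fun _ => (1 : ℝ))) v ≤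
        ((∑ i, n i * (S i).indicator (fun _ => 1) v : ℕ) : ℝ) := by
      rw [Finset.sum_apply, Finset.mul_sum, Nat.cast_sum]
      refine Finset.sum_le_sum fun i _ => ?_
      by_cases hv : v ∈ S i
      · simpa [hv] using Nat.le_ceil (M * w i)
      · simp [hv]
    calc (L : ℝ) * x v ≤ (M + Fintype.card ι) * x v := mul_le_mul_of_nonneg_right hLle (hx v)
      _ < _ := hM v
      _ ≤ _ := mul_le_mul_of_nonneg_left hge hs

/-- The number of services that the vertex `v` is offered in the first `t` slots, when the switch of
speedup `s` runs through the sequence `σ`. -/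
noncomputable def cumulativeService {V : Type*} (σ : ℕ → Set V) (s : ℝ) (v : V) (t : ℕ) : ℕ :=
  ∑ m ∈ Finset.range ⌊s * t⌋₊, (σ m).indicator (fun _ => 1) v

/-- The services offered in a long window of slots exceed those needed for the rate `x`, uniformly in
the position of the window. -/
theorem exists_forall_le_cumulativeService {V : Type*} {σ : ℕ → Set V} {L : ℕ} (hL : 0 < L)
    (hσ : ∀ m, σ (m + L) = σ m) {s x : ℝ} (hs : 0 ≤ s) {v : V}
    (hx : L * x < s * (∑ m ∈ Finset.range L, (σ m).indicator (fun _ => 1) v : ℕ)) :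
    ∃ T₀ : ℕ, ∀ T ≥ T₀, ∀ t : ℕ,
      T * x + cumulativeService σ s v t ≤ cumulativeService σ s v (t + T) := by
  set c := ∑ m ∈ Finset.range L, (σ m).indicator (fun _ => 1) v with hc
  have hL' : (0 : ℝ) < L := by exact_mod_cast hL
  obtain ⟨T₀, hT₀⟩ := exists_nat_ge ((1 + L) * c / (s * c - L * x))
  refine ⟨T₀, fun T hT t => ?_⟩
  have hT' : (1 + L) * c ≤ T * (s * c - L * x) := by
    rw [← div_le_iff₀ (sub_pos.2 hx)]
    exact hT₀.trans (by exact_mod_cast hT)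
  have hfl : ⌊s * t⌋₊ ≤ ⌊s * (t + T : ℕ)⌋₊ := by
    apply Nat.floor_mono
    push_cast
    nlinarith [mul_nonneg hs (Nat.cast_nonneg (α := ℝ) T)]
  set q := (⌊s * (t + T : ℕ)⌋₊ - ⌊s * t⌋₊) / L with hq
  have h1 : ⌊s * t⌋₊ + q * L ≤ ⌊s * (t + T : ℕ)⌋₊ := by
    have := Nat.div_mul_le_self (⌊s * (t + T : ℕ)⌋₊ - ⌊s * t⌋₊) L
    rw [← hq] at this
    omega
  have h2 : ⌊s * (t + T : ℕ)⌋₊ < ⌊s * t⌋₊ + q * L + L := by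
    have := Nat.lt_div_mul_add (a := ⌊s * (t + T : ℕ)⌋₊ - ⌊s * t⌋₊) hL
    rw [← hq] at this
    omega
  have h3 : cumulativeService σ s v t + q * c ≤ cumulativeService σ s v (t + T) := by
    unfold cumulativeService
    rw [hc, ← sum_range_add_mul_of_periodic (fun m => by rw [hσ])]
    exact Finset.sum_le_sum_of_subset (Finset.range_mono h1)
  have h4 : s * T - 1 - L ≤ q * L := by
    have e1 : s * (t + T : ℕ) < ⌊s * (t + T : ℕ)⌋₊ + 1 := Nat.lt_floor_add_one _
    have e2 : (⌊s * t⌋₊ : ℝ) ≤ s * t := Nat.floor_le (mul_nonneg hs (Nat.cast_nonneg t))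
    have e3 : (⌊s * (t + T : ℕ)⌋₊ : ℝ) ≤ ⌊s * t⌋₊ + q * L + L := by exact_mod_cast h2.le
    push_cast at e1 e3
    nlinarith
  have h5 : (T : ℝ) * x ≤ q * c := by
    refine le_of_mul_le_mul_left ?_ hL'
    have := mul_le_mul_of_nonneg_right h4 (Nat.cast_nonneg (α := ℝ) c)
    nlinarith
  have h6 : (cumulativeService σ s v t : ℝ) + q * c ≤ cumulativeService σ s v (t + T) := by
    exact_mod_cast h3
  linarith

end Schedule

namespace TrafficPattern

/-! ### Innovative packets -/

section Innovative

variable (F : Type) [Field F]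

theorem inputKnowledge_eq_span_range (n : ℕ) :
    inputKnowledge F n = Submodule.span F
      (Set.range fun m : Fin n => (Finsupp.single (m : ℕ) (1 : F) : ℕ →₀ F)) := by
  unfold inputKnowledge
  congr 1
  ext v
  constructor
  · rintro ⟨m, hm, rfl⟩
    exact ⟨⟨m, hm⟩, rfl⟩
  · rintro ⟨m, rfl⟩
    exact ⟨m, m.2, rfl⟩

instance finiteDimensional_inputKnowledge (n : ℕ) : FiniteDimensional F (inputKnowledge F n) := by
  rw [inputKnowledge_eq_span_range]
  exact FiniteDimensional.span_of_finite F (Set.finite_range _)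

theorem finrank_inputKnowledge (n : ℕ) : Module.finrank F (inputKnowledge F n) = n := by
  rw [inputKnowledge_eq_span_range, finrank_span_eq_card, Fintype.card_fin]
  exact (Finsupp.basisSingleOne (R := F) (ι := ℕ)).linearIndependent.comp _ Fin.val_injective

theorem inputKnowledge_mono {m n : ℕ} (h : m ≤ n) : inputKnowledge F m ≤ inputKnowledge F n :=
  Submodule.span_mono fun _ ⟨k, hk, hv⟩ => ⟨k, hk.trans_le h, hv⟩

variable {F}

/-- A finite-dimensional vector space over a finite field is not the union of fewer than `|F|` proper
subspaces: these have too few elements. -/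
theorem exists_forall_notMem_of_card_lt [Finite F] {E ι : Type*} [AddCommGroup E] [Module F E]
    [FiniteDimensional F E] [Fintype ι] (hι : Fintype.card ι < Nat.card F) (p : ι → Submodule F E)
    (hp : ∀ j, p j ≠ ⊤) : ∃ v, ∀ j, v ∉ p j := by
  classical
  have : Finite E := Module.finite_of_finite F
  have := Fintype.ofFinite E
  by_contra! hcon
  have hq : 0 < Nat.card F := Nat.card_pos
  cases isEmpty_or_nonempty ι with
  | inl h => exact h.elim (hcon 0).choose
  | inr h =>
    have hpos : 0 < Module.finrank F E := by
      obtain ⟨j⟩ := h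
      exact (Nat.zero_le _).trans_lt (Submodule.finrank_lt (hp j))
    obtain ⟨d, hd⟩ : ∃ d, Module.finrank F E = d + 1 := ⟨_, (Nat.succ_pred hpos.ne').symm⟩
    have hcard : ∀ j, ((p j : Set E).toFinset).card ≤ Nat.card F ^ d := by
      intro j
      have h1 : ((p j : Set E).toFinset).card = Nat.card (p j) := by
        rw [Set.toFinset_card, ← Nat.card_eq_fintype_card]; rfl
      rw [h1, Module.natCard_eq_pow_finrank (K := F)]
      exact Nat.pow_le_pow_right hq (by have := Submodule.finrank_lt (hp j); omega)
    have h2 : Fintype.card E ≤ Fintype.card ι * Nat.card F ^ d := by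
      calc Fintype.card E ≤ (Finset.univ.biUnion fun j => (p j : Set E).toFinset).card := by
            refine Finset.card_le_card fun v _ => ?_
            obtain ⟨j, hj⟩ := hcon v
            exact Finset.mem_biUnion.2 ⟨j, Finset.mem_univ _, by simpa using hj⟩
        _ ≤ ∑ j : ι, ((p j : Set E).toFinset).card := Finset.card_biUnion_le
        _ ≤ ∑ _j : ι, Nat.card F ^ d := Finset.sum_le_sum fun j _ => hcard j
        _ = _ := by simp
    rw [← Nat.card_eq_fintype_card, Module.natCard_eq_pow_finrank (K := F), hd, pow_succ'] at h2
    exact absurd h2 (not_le.2 (Nat.mul_lt_mul_of_pos_right hι (pow_pos hq d)))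

/-- When `W j` is what output `j` knows about a flow of which `n` packets have arrived, `v` is a packet
that is new to every output which does not know the whole flow yet. -/
def IsInnovative {N : ℕ} (n : ℕ) (W : Fin N → Submodule F (ℕ →₀ F)) (v : ℕ →₀ F) : Prop :=
  v ∈ inputKnowledge F n ∧ ∀ j, W j ≠ inputKnowledge F n → v ∉ W j

theorem exists_isInnovative [Finite F] {N : ℕ} (hN : N < Nat.card F) {n : ℕ}
    {W : Fin N → Submodule F (ℕ →₀ F)} (hW : ∀ j, W j ≤ inputKnowledge F n) :
    ∃ v, IsInnovative n W v := by
  classical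
  obtain ⟨v, hv⟩ := exists_forall_notMem_of_card_lt (F := F) (E := inputKnowledge F n)
    (ι := {j : Fin N // W j ≠ inputKnowledge F n})
    ((Fintype.card_subtype_le _).trans_lt (by simpa using hN))
    (fun j => (W j.1).comap (inputKnowledge F n).subtype)
    (fun j hj => j.2 ((hW j.1).antisymm (Submodule.comap_subtype_eq_top.1 hj)))
  exact ⟨v, v.2, fun j hj hmem => hv ⟨j, hj⟩ hmem⟩

open Classical in
/-- A choice of an innovative packet. The junk value `0` is used only if there is none. -/
noncomputable def innovative {N : ℕ} (n : ℕ) (W : Fin N → Submodule F (ℕ →₀ F)) : ℕ →₀ F :=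
  if h : ∃ v, IsInnovative n W v then h.choose else 0

theorem innovative_mem {N : ℕ} (n : ℕ) (W : Fin N → Submodule F (ℕ →₀ F)) :
    innovative n W ∈ inputKnowledge F n := by
  unfold innovative
  split_ifs with h
  · exact h.choose_spec.1
  · exact zero_mem _

theorem isInnovative_innovative [Finite F] {N : ℕ} (hN : N < Nat.card F) {n : ℕ}
    {W : Fin N → Submodule F (ℕ →₀ F)} (hW : ∀ j, W j ≤ inputKnowledge F n) :
    IsInnovative n W (innovative n W) := by
  have h := exists_isInnovative hN hW
  rw [innovative, dif_pos h]
  exact h.choose_spec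

/-- Adding a vector outside a subspace takes one off its codimension. -/
theorem sub_finrank_le_of_notMem {n : ℕ} {W W' : Submodule F (ℕ →₀ F)} {v : ℕ →₀ F} (hle : W ≤ W')
    (hW' : W' ≤ inputKnowledge F n) (hv : W ≠ inputKnowledge F n → v ∉ W) (hvW' : v ∈ W') :
    n - Module.finrank F W' ≤ n - Module.finrank F W - 1 := by
  have := Submodule.finiteDimensional_of_le hW'
  by_cases h : W = inputKnowledge F n
  · have h2 := Submodule.finrank_mono hle
    rw [h, finrank_inputKnowledge] at h2
    omega
  · have hlt : W < W' := lt_of_le_of_ne hle fun e => hv h (e ▸ hvW')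
    have := Submodule.finrank_lt_finrank_of_lt hlt
    omega

end Innovative

/-! ### The coding scheme that serves a sequence of stable sets -/

section Scheme

variable {K N : ℕ} {P : TrafficPattern K N} {F : Type} [Field F]

open Classical in
/-- The configuration that serves the subflows in `S`, if `S` is stable: the input of a subflow in `S`
sends the packet `v f` of its flow `f`, and the outputs of the subflows in `S` listen to their
inputs. If `S` is not stable, arbitrary choices are made. -/
noncomputable def serve (S : Set P.Subflow) (v : P.Flow → ℕ →₀ F) : P.Config F where
  packet i := if h : ∃ w ∈ S, w.1.input = i then some (h.choose.1, v h.choose.1) else none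
  packet_input i f x hx := by
    split_ifs at hx with h
    obtain ⟨rfl, -⟩ := Prod.mk.inj (Option.some.inj hx)
    exact h.choose_spec.2
  source j := if h : ∃ w ∈ S, w.2.1 = j then some h.choose.1.input else none

theorem eq_of_packet_serve {S : Set P.Subflow} {v : P.Flow → ℕ →₀ F} {i : Fin K} {f : P.Flow}
    {x : ℕ →₀ F} (h : (serve S v).packet i = some (f, x)) : x = v f := by
  unfold serve at h
  dsimp only at h
  split_ifs at h
  obtain ⟨rfl, rfl⟩ := Prod.mk.inj (Option.some.inj h)
  rfl

/-- Stability makes the choices in `serve` unique: subflows in `S` with the same input belong to the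
same flow, and subflows in `S` with the same output coincide. -/
theorem delivers_serve {S : Set P.Subflow} (hS : P.enhancedConflictGraph.IsIndepSet S)
    (v : P.Flow → ℕ →₀ F) {w : P.Subflow} (hw : w ∈ S) :
    (serve S v).Delivers w.2.1 w.1 (v w.1) := by
  refine ⟨w.1.input, ?_, ?_⟩
  · have h : ∃ u ∈ S, u.2.1 = w.2.1 := ⟨w, hw, rfl⟩
    have hu : h.choose = w := by
      by_contra hne
      exact hS h.choose_spec.1 hw hne ⟨hne, Or.inl h.choose_spec.2⟩
    unfold serve
    dsimp only
    rw [dif_pos h, hu]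
  · have h : ∃ u ∈ S, u.1.input = w.1.input := ⟨w, hw, rfl⟩
    have hu : h.choose.1 = w.1 := by
      by_contra hne
      have hne' : h.choose ≠ w := fun e => hne (by rw [e])
      exact hS h.choose_spec.1 hw hne' ⟨hne', Or.inr ⟨h.choose_spec.2, fun e =>
        hne (flow_ext h.choose_spec.2 e)⟩⟩
    unfold serve
    dsimp only
    rw [dif_pos h, hu]

variable (P F) in
/-- What every output knows about every flow. -/
abbrev Knowledge : Type := P.Flow → Fin N → Submodule F (ℕ →₀ F)

/-- The configuration that serves the subflows in `S` with packets that are innovative for the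
knowledge `W`, when `n f` packets of each flow `f` have arrived. -/
noncomputable def serveInnovative (S : Set P.Subflow) (n : P.Flow → ℕ) (W : Knowledge P F) :
    P.Config F :=
  serve S fun f => innovative (n f) (W f)

/-- The knowledge after the first `k` configurations of slot `t`, if it is `W` at the beginning of the
slot. The `m`-th configuration since the start of the switch serves `σ m`. -/
noncomputable def knowledgeInSlot (σ : ℕ → Set P.Subflow) (s : ℝ) (t : ℕ) (n : P.Flow → ℕ)
    (W : Knowledge P F) : ℕ → Knowledge P F
  | 0 => W
  | k + 1 => fun f j => knowledgeInSlot σ s t n W k f j ⊔ Submodule.span F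
      {v | (serveInnovative (σ (⌊s * t⌋₊ + k)) n (knowledgeInSlot σ s t n W k)).Delivers j f v}

/-- The knowledge at the beginning of slot `t`, when `a u f` packets of flow `f` arrive in slot `u`. -/
noncomputable def knowledge (σ : ℕ → Set P.Subflow) (s : ℝ) (a : ℕ → P.Flow → ℕ) :
    ℕ → Knowledge P F
  | 0 => fun _ _ => ⊥
  | t + 1 => knowledgeInSlot σ s t (fun f => ∑ u ∈ Finset.range t, a u f) (knowledge σ s a t)
      (configsInSlot s t)

theorem knowledge_congr (σ : ℕ → Set P.Subflow) (s : ℝ) {a a' : ℕ → P.Flow → ℕ} {t : ℕ}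
    (h : ∀ u < t, a u = a' u) :
    (knowledge σ s a t : Knowledge P F) = knowledge σ s a' t := by
  induction t with
  | zero => rfl
  | succ t ih =>
    have h1 : (fun f => ∑ u ∈ Finset.range t, a u f) = fun f => ∑ u ∈ Finset.range t, a' u f :=
      funext fun f => Finset.sum_congr rfl fun u hu => by
        rw [h u ((Finset.mem_range.1 hu).trans t.lt_succ_self)]
    rw [knowledge, knowledge, ih fun u hu => h u (hu.trans t.lt_succ_self), h1]

/-- The arrivals of a finite history, with no arrivals afterwards. -/
def extendHistory {t : ℕ} (h : Fin t → P.Flow → ℕ) (u : ℕ) : P.Flow → ℕ :=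
  if hu : u < t then h ⟨u, hu⟩ else 0

variable (F) in
/-- The scheme whose `m`-th configuration serves `σ m`, with innovative packets. -/
noncomputable def innovativeScheme (σ : ℕ → Set P.Subflow) (s : ℝ) : P.Scheme F where
  config t h k := serveInnovative (σ (⌊s * t⌋₊ + k)) (fun f => ∑ u, h u f)
    (knowledgeInSlot σ s t (fun f => ∑ u, h u f) (knowledge σ s (extendHistory h) t) k)
  causal t h k i f v hv := by
    rw [eq_of_packet_serve hv]
    exact innovative_mem _ _

theorem config_innovativeScheme (σ : ℕ → Set P.Subflow) (s : ℝ) (a : ℕ → P.Flow → ℕ) (t k : ℕ) :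
    (innovativeScheme F σ s).config t (fun u : Fin t => a u) k =
      serveInnovative (σ (⌊s * t⌋₊ + k)) (fun f => ∑ u ∈ Finset.range t, a u f)
        (knowledgeInSlot σ s t (fun f => ∑ u ∈ Finset.range t, a u f) (knowledge σ s a t) k) := by
  have h : (knowledge σ s (extendHistory fun u : Fin t => a u) t : Knowledge P F) =
      knowledge σ s a t := knowledge_congr σ s fun u hu => by simp [extendHistory, hu]
  simp only [innovativeScheme, h, Finset.sum_range]

theorem knowledgeInSlot_eq_sup_span (σ : ℕ → Set P.Subflow) (s : ℝ) (t : ℕ) (n : P.Flow → ℕ)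
    (W : Knowledge P F) (k : ℕ) (f : P.Flow) (j : Fin N) :
    knowledgeInSlot σ s t n W k f j = W f j ⊔ Submodule.span F {v | ∃ l < k,
      (serveInnovative (σ (⌊s * t⌋₊ + l)) n (knowledgeInSlot σ s t n W l)).Delivers j f v} := by
  induction k with
  | zero => simp [knowledgeInSlot]
  | succ k ih =>
    rw [knowledgeInSlot]
    simp only [Nat.exists_lt_succ_right, Set.ofPred_or, Submodule.span_union, ← sup_assoc, ih]

/-- The recursively computed knowledge is the actual knowledge of the outputs. -/
theorem outputKnowledge_innovativeScheme (σ : ℕ → Set P.Subflow) (s : ℝ) (a : ℕ → P.Flow → ℕ)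
    (f : P.Flow) (j : Fin N) (t : ℕ) :
    (innovativeScheme F σ s).outputKnowledge s a f j t = knowledge σ s a t f j := by
  induction t with
  | zero => simp [Scheme.outputKnowledge, knowledge]
  | succ t ih =>
    rw [knowledge, knowledgeInSlot_eq_sup_span, ← ih]
    simp only [Scheme.outputKnowledge, Nat.exists_lt_succ_right, Set.ofPred_or,
      Submodule.span_union, config_innovativeScheme]

theorem virtualQueue_innovativeScheme (σ : ℕ → Set P.Subflow) (s : ℝ) (a : ℕ → P.Flow → ℕ)
    (w : P.Subflow) (t : ℕ) :
    (innovativeScheme F σ s).virtualQueue s a w t =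
      ∑ u ∈ Finset.range t, a u w.1 - Module.finrank F (knowledge (F := F) σ s a t w.1 w.2.1) := by
  rw [Scheme.virtualQueue, finrank_inputKnowledge, outputKnowledge_innovativeScheme]

/-- The virtual queues are functions of the history. -/
theorem virtualQueue_innovativeScheme_congr (σ : ℕ → Set P.Subflow) (s : ℝ)
    {a a' : ℕ → P.Flow → ℕ} {t : ℕ} (h : ∀ u < t, a u = a' u) (w : P.Subflow) :
    (innovativeScheme F σ s).virtualQueue s a w t =
      (innovativeScheme F σ s).virtualQueue s a' w t := by
  rw [virtualQueue_innovativeScheme, virtualQueue_innovativeScheme, knowledge_congr σ s h]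
  congr 1
  exact Finset.sum_congr rfl fun u hu => by rw [h u (Finset.mem_range.1 hu)]

theorem knowledgeInSlot_le {σ : ℕ → Set P.Subflow} {s : ℝ} {t : ℕ} {n : P.Flow → ℕ}
    {W : Knowledge P F} (hW : ∀ f j, W f j ≤ inputKnowledge F (n f)) (k : ℕ) (f : P.Flow)
    (j : Fin N) : knowledgeInSlot σ s t n W k f j ≤ inputKnowledge F (n f) := by
  rw [knowledgeInSlot_eq_sup_span]
  refine sup_le (hW f j) (Submodule.span_le.2 ?_)
  rintro v ⟨l, -, i, -, hi⟩
  rw [eq_of_packet_serve hi]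
  exact innovative_mem _ _

theorem knowledge_le (σ : ℕ → Set P.Subflow) (s : ℝ) (a : ℕ → P.Flow → ℕ) (t : ℕ) (f : P.Flow)
    (j : Fin N) : (knowledge σ s a t f j : Submodule F (ℕ →₀ F)) ≤
      inputKnowledge F (∑ u ∈ Finset.range t, a u f) := by
  induction t generalizing f j with
  | zero => simp [knowledge]
  | succ t ih =>
    refine (knowledgeInSlot_le ih _ f j).trans (inputKnowledge_mono F ?_)
    rw [Finset.sum_range_succ]
    exact Nat.le_add_right _ _

/-- Within a slot, every configuration that serves a subflow takes one packet off its virtual queue,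
unless the queue is empty. -/
theorem sub_finrank_knowledgeInSlot_le [Finite F] (hN : N < Nat.card F) {σ : ℕ → Set P.Subflow}
    (hσ : ∀ m, P.enhancedConflictGraph.IsIndepSet (σ m)) {s : ℝ} {t : ℕ} {n : P.Flow → ℕ}
    {W : Knowledge P F} (hW : ∀ f j, W f j ≤ inputKnowledge F (n f)) (w : P.Subflow) (k : ℕ) :
    n w.1 - Module.finrank F (knowledgeInSlot σ s t n W k w.1 w.2.1) ≤
      n w.1 - Module.finrank F (W w.1 w.2.1) -
        ∑ l ∈ Finset.range k, (σ (⌊s * t⌋₊ + l)).indicator (fun _ => 1) w := by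
  induction k with
  | zero =>
    rw [Finset.range_zero, Finset.sum_empty, Nat.sub_zero]
    exact le_rfl
  | succ k ih =>
    have hle : knowledgeInSlot σ s t n W k w.1 w.2.1 ≤
        knowledgeInSlot σ s t n W (k + 1) w.1 w.2.1 := le_sup_left
    have hle' := knowledgeInSlot_le (σ := σ) (s := s) (t := t) hW (k + 1) w.1 w.2.1
    rw [Finset.sum_range_succ]
    by_cases hw : w ∈ σ (⌊s * t⌋₊ + k)
    · have hinn := isInnovative_innovative hN
        (fun j => knowledgeInSlot_le (σ := σ) (s := s) (t := t) hW k w.1 j)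
      have := sub_finrank_le_of_notMem hle hle' (hinn.2 w.2.1)
        (Submodule.mem_sup_right (Submodule.subset_span (delivers_serve (hσ _) _ hw)))
      rw [Set.indicator_of_mem hw]
      omega
    · have := Submodule.finiteDimensional_of_le hle'
      have := Submodule.finrank_mono hle
      rw [Set.indicator_of_notMem hw]
      omega

/-- The queue dynamics: in each slot, the offered services are taken off the virtual queue, and then
the new arrivals join it. -/
theorem virtualQueue_succ_le [Finite F] (hN : N < Nat.card F) {σ : ℕ → Set P.Subflow}
    (hσ : ∀ m, P.enhancedConflictGraph.IsIndepSet (σ m)) {s : ℝ} (hs : 0 ≤ s)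
    (a : ℕ → P.Flow → ℕ) (w : P.Subflow) (t : ℕ) :
    (innovativeScheme F σ s).virtualQueue s a w (t + 1) ≤
      (innovativeScheme F σ s).virtualQueue s a w t -
        (cumulativeService σ s w (t + 1) - cumulativeService σ s w t) + a t w.1 := by
  have h := sub_finrank_knowledgeInSlot_le hN hσ (s := s) (t := t) (knowledge_le (F := F) σ s a t)
    w (configsInSlot s t)
  have hfl : ⌊s * t⌋₊ ≤ ⌊s * (t + 1 : ℕ)⌋₊ :=
    Nat.floor_mono (mul_le_mul_of_nonneg_left (by exact_mod_cast t.le_succ) hs)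
  have hB : cumulativeService σ s w (t + 1) = cumulativeService σ s w t +
      ∑ l ∈ Finset.range (configsInSlot s t), (σ (⌊s * t⌋₊ + l)).indicator (fun _ => 1) w := by
    rw [cumulativeService, cumulativeService, ← Finset.sum_range_add, configsInSlot,
      Nat.add_sub_cancel' hfl]
  rw [virtualQueue_innovativeScheme, virtualQueue_innovativeScheme, hB, knowledge,
    Finset.sum_range_succ]
  omega

theorem virtualQueue_le_sum (π : P.Scheme F) (s : ℝ) (a : ℕ → P.Flow → ℕ) (w : P.Subflow) (t : ℕ) :
    π.virtualQueue s a w t ≤ ∑ u ∈ Finset.range t, a u w.1 := by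
  rw [Scheme.virtualQueue, finrank_inputKnowledge]
  exact Nat.sub_le _ _

end Scheme

end TrafficPattern

/-! ### Strong stability by quadratic drift -/

section Drift

/-- The Foster–Lyapunov bound: a drift of `-κ U + C` over windows of length `T` bounds the sums
of `U`. -/
theorem mul_sum_le_of_drift {V U : ℕ → ℝ} (hV : ∀ t, 0 ≤ V t) {T : ℕ} {κ C : ℝ}
    (h : ∀ t, V (t + T) ≤ V t - κ * U t + C) (n : ℕ) :
    κ * ∑ t ∈ Finset.range n, U t ≤ ∑ t ∈ Finset.range T, V t + n * C := by
  have h1 : ∑ t ∈ Finset.range n, V (t + T) ≤ ∑ t ∈ Finset.range n, (V t - κ * U t + C) :=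
    Finset.sum_le_sum fun t _ => h t
  rw [Finset.sum_add_distrib, Finset.sum_sub_distrib, ← Finset.mul_sum, Finset.sum_const,
    Finset.card_range, nsmul_eq_mul] at h1
  have h2 := Finset.sum_range_add V T n
  have h3 : ∑ t ∈ Finset.range n, V t ≤ ∑ t ∈ Finset.range (T + n), V t :=
    Finset.sum_le_sum_of_subset_of_nonneg (Finset.range_mono (Nat.le_add_left n T))
      fun t _ _ => hV t
  simp only [add_comm T] at h2 h3
  linarith

/-- A weight that is measurable with respect to the past sees only the conditional expectation. -/
theorem integral_mul_le_of_condExp_le {Ω : Type*} {m m₀ : MeasurableSpace Ω} {μ : Measure Ω}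
    [IsFiniteMeasure μ] (hm : m ≤ m₀) {Z A : Ω → ℝ} {c : ℝ} (hZ : StronglyMeasurable[m] Z)
    (hZ0 : ∀ ω, 0 ≤ Z ω) (hZi : Integrable Z μ) (hA : Integrable A μ)
    (hZA : Integrable (fun ω => Z ω * A ω) μ) (h : μ[A | m] ≤ᵐ[μ] fun _ => c) :
    ∫ ω, Z ω * A ω ∂μ ≤ c * ∫ ω, Z ω ∂μ := by
  have hpull : μ[fun ω => Z ω * A ω | m] =ᵐ[μ] fun ω => Z ω * (μ[A | m]) ω :=
    condExp_mul_of_stronglyMeasurable_left (f := Z) (g := A) hZ hZA hA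
  rw [← integral_condExp hm (f := fun ω => Z ω * A ω), integral_congr_ae hpull,
    ← integral_const_mul]
  refine integral_mono_ae (integrable_condExp.congr hpull) (hZi.const_mul c) ?_
  filter_upwards [h] with ω hω
  rw [mul_comm c]
  exact mul_le_mul_of_nonneg_left hω (hZ0 ω)

theorem stronglyStable_of_sum_integral_le {Ω : Type} [MeasurableSpace Ω] {μ : Measure Ω}
    {U : ℕ → Ω → ℕ} (hU : ∀ t, Integrable (fun ω => (U t ω : ℝ)) μ) {D C : ℝ}
    (h : ∀ n : ℕ, ∑ t ∈ Finset.range n, ∫ ω, (U t ω : ℝ) ∂μ ≤ D + n * C) :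
    TrafficPattern.StronglyStable μ U := by
  have hD : 0 ≤ D := by simpa using h 0
  have key : ∀ n : ℕ, (∑ u ∈ Finset.range n, ∫⁻ ω, (U u ω : ℝ≥0∞) ∂μ) / n ≤
      ENNReal.ofReal (D + |C|) := by
    intro n
    refine ENNReal.div_le_of_le_mul ?_
    have e : ∀ u, ∫⁻ ω, (U u ω : ℝ≥0∞) ∂μ = ENNReal.ofReal (∫ ω, (U u ω : ℝ) ∂μ) := by
      intro u
      rw [ofReal_integral_eq_lintegral_ofReal (hU u) (ae_of_all _ fun ω => Nat.cast_nonneg _)]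
      simp only [ENNReal.ofReal_natCast]
    simp only [e]
    rw [← ENNReal.ofReal_sum_of_nonneg fun u _ => integral_nonneg fun ω => Nat.cast_nonneg _,
      ← ENNReal.ofReal_natCast n, ← ENNReal.ofReal_mul (by positivity)]
    refine ENNReal.ofReal_le_ofReal ?_
    rcases Nat.eq_zero_or_pos n with rfl | hn
    · simp
    · have h1 : (1 : ℝ) ≤ n := by exact_mod_cast hn
      have h2 := le_abs_self C
      have h3 := h n
      nlinarith
  exact (limsup_le_of_le (h := Eventually.of_forall key)).trans_lt ENNReal.ofReal_lt_top

end Drift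

section ArrivalStream

variable {K N : ℕ} {P : TrafficPattern K N} {Ω : Type}

namespace TrafficPattern

theorem history_mono (a : ℕ → P.Flow → Ω → ℕ) {t t' : ℕ} (h : t ≤ t') :
    history a t ≤ history a t' :=
  iSup_le fun u => le_iSup_of_le (Fin.castLE h u) le_rfl

/-- Every function of the arrivals before slot `t` is measurable with respect to the history: there
are only countably many possible arrivals in finitely many slots. -/
theorem measurable_history_of_congr (a : ℕ → P.Flow → Ω → ℕ) {t : ℕ}
    {g : (ℕ → P.Flow → ℕ) → ℕ} (hg : ∀ b b', (∀ u < t, b u = b' u) → g b = g b') :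
    Measurable[history a t] fun ω => g fun u f => a u f ω := by
  let m := history a t
  have h1 : Measurable[m] fun ω => fun (u : Fin t) (f : P.Flow) => a u f ω := by
    refine measurable_pi_lambda _ fun u => measurable_pi_lambda _ fun f => ?_
    refine Measurable.mono (comap_measurable (a u f)) ?_ le_rfl
    exact le_iSup_of_le u (le_iSup_of_le f le_rfl)
  have h2 : (fun ω => g fun u f => a u f ω) =
      (fun h : Fin t → P.Flow → ℕ => g (extendHistory h)) ∘
        fun ω => fun (u : Fin t) (f : P.Flow) => a u f ω := by
    funext ω
    refine hg _ _ fun u hu => ?_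
    simp [extendHistory, hu]
  rw [h2]
  exact Measurable.of_discrete.comp h1

variable [mΩ : MeasurableSpace Ω] {μ : Measure Ω} {a : ℕ → P.Flow → Ω → ℕ} {r : P.Flow → ℝ}

theorem history_le (ha : ∀ t f, Measurable (a t f)) (t : ℕ) : history a t ≤ mΩ :=
  iSup_le fun u => iSup_le fun f => (ha u f).comap_le

namespace IsArrivalStream

theorem memLp (ha : P.IsArrivalStream μ a r) (t : ℕ) (f : P.Flow) :
    MemLp (fun ω => (a t f ω : ℝ)) 2 μ :=
  (memLp_two_iff_integrable_sq
    (measurable_from_top.comp (ha.measurable t f)).aestronglyMeasurable).2 (ha.sq_integrable t f)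

theorem memLp_sum (ha : P.IsArrivalStream μ a r) (f : P.Flow) (t T : ℕ) :
    MemLp (fun ω => ∑ k ∈ Finset.range T, (a (t + k) f ω : ℝ)) 2 μ :=
  memLp_finsetSum _ fun k _ => ha.memLp (t + k) f

theorem exists_integral_sq_le [IsProbabilityMeasure μ] (ha : P.IsArrivalStream μ a r)
    (f : P.Flow) : ∃ C : ℝ, ∀ t, ∫ ω, (a t f ω : ℝ) ^ 2 ∂μ ≤ C := by
  obtain ⟨A, hA⟩ := ha.second_moment f
  refine ⟨A ^ 2, fun t => ?_⟩
  rw [← integral_condExp (history_le ha.measurable t)]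
  simpa using integral_mono_ae integrable_condExp (integrable_const (A ^ 2)) (hA t)

theorem exists_integral_sq_sum_le [IsProbabilityMeasure μ] (ha : P.IsArrivalStream μ a r)
    (f : P.Flow) (T : ℕ) :
    ∃ C : ℝ, ∀ t, ∫ ω, (∑ k ∈ Finset.range T, (a (t + k) f ω : ℝ)) ^ 2 ∂μ ≤ C := by
  obtain ⟨C, hC⟩ := ha.exists_integral_sq_le f
  refine ⟨T * ∑ k ∈ Finset.range T, C, fun t => ?_⟩
  calc ∫ ω, (∑ k ∈ Finset.range T, (a (t + k) f ω : ℝ)) ^ 2 ∂μ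
      ≤ ∫ ω, T * ∑ k ∈ Finset.range T, (a (t + k) f ω : ℝ) ^ 2 ∂μ := by
        refine integral_mono (ha.memLp_sum f t T).integrable_sq
          ((integrable_finsetSum _ fun k _ => ha.sq_integrable (t + k) f).const_mul _)
          fun ω => ?_
        simpa using sq_sum_le_card_mul_sum_sq (s := Finset.range T)
          (f := fun k => (a (t + k) f ω : ℝ))
    _ = T * ∑ k ∈ Finset.range T, ∫ ω, (a (t + k) f ω : ℝ) ^ 2 ∂μ := by
        rw [integral_const_mul, integral_finsetSum _ fun k _ => ha.sq_integrable (t + k) f]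
    _ ≤ _ := mul_le_mul_of_nonneg_left (Finset.sum_le_sum fun k _ => hC (t + k))
        (Nat.cast_nonneg T)

/-- The window condition, in integrated form and for windows of `n T` slots: each of the `n` blocks of
`T` slots is conditioned on its own past, which contains the past of the whole window. -/
theorem exists_integral_mul_sum_le [IsProbabilityMeasure μ] (ha : P.IsArrivalStream μ a r)
    (f : P.Flow) {δ : ℝ} (hδ : 0 < δ) : ∃ T : ℕ, 0 < T ∧ ∀ (n t : ℕ) (Z : Ω → ℝ),
      Measurable[history a t] Z → (∀ ω, 0 ≤ Z ω) → MemLp Z 2 μ →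
      ∫ ω, Z ω * ∑ k ∈ Finset.range (n * T), (a (t + k) f ω : ℝ) ∂μ ≤
        (n * T : ℕ) * (r f + δ) * ∫ ω, Z ω ∂μ := by
  obtain ⟨T, hT, hw⟩ := ha.window f δ hδ
  have hT' : (0 : ℝ) < T := by exact_mod_cast hT
  refine ⟨T, hT, fun n t Z hZ hZ0 hZ2 => ?_⟩
  induction n with
  | zero => simp
  | succ n ih =>
    have hblock : ∫ ω, Z ω * ((∑ k ∈ Finset.range T, (a (t + n * T + k) f ω : ℝ)) / T) ∂μ ≤
        (r f + δ) * ∫ ω, Z ω ∂μ := by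
      have hA : MemLp (fun ω => (∑ k ∈ Finset.range T, (a (t + n * T + k) f ω : ℝ)) / T) 2 μ := by
        simpa only [div_eq_inv_mul] using (ha.memLp_sum f (t + n * T) T).const_mul (T : ℝ)⁻¹
      exact integral_mul_le_of_condExp_le (history_le ha.measurable _)
        (hZ.mono (history_mono a (Nat.le_add_right t (n * T))) le_rfl).stronglyMeasurable hZ0
        (hZ2.integrable one_le_two) (hA.integrable one_le_two) (hZ2.integrable_mul hA)
        (hw (t + n * T))
    have hsplit : ∫ ω, Z ω * ∑ k ∈ Finset.range ((n + 1) * T), (a (t + k) f ω : ℝ) ∂μ =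
        ∫ ω, Z ω * ∑ k ∈ Finset.range (n * T), (a (t + k) f ω : ℝ) ∂μ +
          T * ∫ ω, Z ω * ((∑ k ∈ Finset.range T, (a (t + n * T + k) f ω : ℝ)) / T) ∂μ := by
      have i1 : Integrable (fun ω => Z ω * ∑ k ∈ Finset.range (n * T), (a (t + k) f ω : ℝ)) μ :=
        hZ2.integrable_mul (ha.memLp_sum f t (n * T))
      have i2 : Integrable (fun ω => Z ω * ∑ k ∈ Finset.range T, (a (t + n * T + k) f ω : ℝ)) μ :=
        hZ2.integrable_mul (ha.memLp_sum f (t + n * T) T)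
      have e : ∀ ω, T * (Z ω * ((∑ k ∈ Finset.range T, (a (t + n * T + k) f ω : ℝ)) / T)) =
          Z ω * ∑ k ∈ Finset.range T, (a (t + n * T + k) f ω : ℝ) := fun ω => by field_simp
      rw [← integral_const_mul]
      simp only [e]
      rw [← integral_add i1 i2]
      simp only [add_mul, one_mul, Finset.sum_range_add, ← add_assoc, mul_add]
    rw [hsplit]
    have := mul_le_mul_of_nonneg_left hblock hT'.le
    push_cast at ih ⊢
    linarith

/-- A queue with arrivals `a · f` that is offered more service than the rate `r f` in all long windows
is strongly stable. Its square has negative drift over a window that is a multiple of the window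
of the arrival process. -/
theorem stronglyStable_of_service [IsProbabilityMeasure μ] (ha : P.IsArrivalStream μ a r)
    (f : P.Flow) {U : ℕ → Ω → ℕ} {B : ℕ → ℕ} {x : ℝ} (hx0 : 0 ≤ x) (hx : r f < x)
    (hUm : ∀ t, Measurable[history a t] (U t))
    (hUle : ∀ t ω, U t ω ≤ ∑ u ∈ Finset.range t, a u f ω)
    (hstep : ∀ t ω, U (t + 1) ω ≤ U t ω - (B (t + 1) - B t) + a t f ω) (hBm : Monotone B)
    (hB : ∃ T₀ : ℕ, ∀ T ≥ T₀, ∀ t : ℕ, T * x + B t ≤ B (t + T)) :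
    StronglyStable μ U := by
  obtain ⟨T₀, hB⟩ := hB
  set δ := (x - r f) / 2 with hδ
  have hδ0 : 0 < δ := by rw [hδ]; linarith
  obtain ⟨T₁, hT₁, hwin⟩ := ha.exists_integral_mul_sum_le f hδ0
  -- a multiple of the window of the arrivals that is long enough for the services
  set T := (T₀ + 1) * T₁ with hT
  have hTT₀ : T₀ ≤ T := by rw [hT]; nlinarith
  have hTpos : (0 : ℝ) < T := by exact_mod_cast Nat.mul_pos T₀.succ_pos hT₁
  obtain ⟨C, hC⟩ := ha.exists_integral_sq_sum_le f T
  have hwindow : ∀ T t ω, U (t + T) ω ≤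
      U t ω - (B (t + T) - B t) + ∑ k ∈ Finset.range T, a (t + k) f ω := by
    intro T t ω
    induction T with
    | zero => simp
    | succ T ih =>
      have h1 := hstep (t + T) ω
      have h2 := hBm (Nat.le_add_right t T)
      have h3 := hBm (Nat.le_succ (t + T))
      rw [Finset.sum_range_succ, ← add_assoc t T 1]
      simp only [Nat.succ_eq_add_one] at h3
      omega
  have hUL2 : ∀ t, MemLp (fun ω => (U t ω : ℝ)) 2 μ := by
    intro t
    refine MemLp.mono (ha.memLp_sum f 0 t) ?_ (ae_of_all _ fun ω => ?_)
    · exact (measurable_from_top.comp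
        ((hUm t).mono (history_le ha.measurable t) le_rfl)).aestronglyMeasurable
    · rw [Real.norm_of_nonneg (Nat.cast_nonneg _),
        Real.norm_of_nonneg (Finset.sum_nonneg fun _ _ => Nat.cast_nonneg _)]
      simpa using (Nat.cast_le (α := ℝ)).2 (hUle t ω)
  have hdrift : ∀ t, ∫ ω, (U (t + T) ω : ℝ) ^ 2 ∂μ ≤
      ∫ ω, (U t ω : ℝ) ^ 2 ∂μ - (2 * T * δ) * ∫ ω, (U t ω : ℝ) ∂μ + ((T * x) ^ 2 + C) := by
    intro t
    set A : Ω → ℝ := fun ω => ∑ k ∈ Finset.range T, (a (t + k) f ω : ℝ) with hA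
    have hAL2 : MemLp A 2 μ := ha.memLp_sum f t T
    -- `max (U - T x) 0 ^ 2 ≤ (U - T x) ^ 2`, and the cross term is at most `2 U A`
    have hpt : ∀ ω, (U (t + T) ω : ℝ) ^ 2 ≤ (U t ω : ℝ) ^ 2 - 2 * (T * x) * U t ω + (T * x) ^ 2 +
        2 * (U t ω * A ω) + A ω ^ 2 := by
      intro ω
      have hA0 : 0 ≤ A ω := Finset.sum_nonneg fun _ _ => Nat.cast_nonneg _
      have hU0 : (0 : ℝ) ≤ U t ω := Nat.cast_nonneg _
      have hV0 : (0 : ℝ) ≤ U (t + T) ω := Nat.cast_nonneg _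
      have hβ : 0 ≤ T * x := mul_nonneg hTpos.le hx0
      have hw : (U (t + T) ω : ℝ) ≤ max (U t ω - T * x) 0 + A ω := by
        have h1 : (U (t + T) ω : ℝ) ≤
            ((U t ω - (B (t + T) - B t) : ℕ) : ℝ) + A ω := by
          simp only [hA]
          exact_mod_cast hwindow T t ω
        have h2 : ((U t ω - (B (t + T) - B t) : ℕ) : ℝ) ≤ max (U t ω - T * x) 0 := by
          have hb := hB T hTT₀ t
          rcases le_total (B (t + T) - B t) (U t ω) with h | h
          · rw [Nat.cast_sub h, Nat.cast_sub (hBm (Nat.le_add_right t T))]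
            exact le_max_of_le_left (by linarith)
          · rw [Nat.sub_eq_zero_of_le h]
            exact_mod_cast le_max_right _ _
        linarith
      have hm1 : max (U t ω - T * x) 0 ≤ (U t ω : ℝ) := max_le (by linarith) hU0
      have hm2 : max (U t ω - T * x) 0 ^ 2 ≤ (U t ω - T * x) ^ 2 := by
        rcases max_cases ((U t ω : ℝ) - T * x) 0 with h | h
        · rw [h.1]
        · rw [h.1]; simpa using sq_nonneg ((U t ω : ℝ) - T * x)
      have hm3 : (U (t + T) ω : ℝ) ^ 2 ≤ (max (U t ω - T * x) 0 + A ω) ^ 2 :=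
        pow_le_pow_left₀ hV0 hw 2
      nlinarith [mul_le_mul_of_nonneg_right hm1 hA0]
    have i1 : Integrable (fun ω => (U t ω : ℝ) ^ 2) μ := (hUL2 t).integrable_sq
    have i2 : Integrable (fun ω => 2 * (T * x) * (U t ω : ℝ)) μ :=
      ((hUL2 t).integrable one_le_two).const_mul _
    have i3 : Integrable (fun ω => 2 * (U t ω * A ω)) μ :=
      ((hUL2 t).integrable_mul hAL2).const_mul 2
    have i4 : Integrable (fun ω => A ω ^ 2) μ := hAL2.integrable_sq
    have j1 : Integrable (fun ω => (U t ω : ℝ) ^ 2 - 2 * (T * x) * U t ω) μ := i1.sub i2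
    have j2 : Integrable (fun ω => (U t ω : ℝ) ^ 2 - 2 * (T * x) * U t ω + (T * x) ^ 2) μ :=
      j1.add (integrable_const _)
    have j3 : Integrable (fun ω => (U t ω : ℝ) ^ 2 - 2 * (T * x) * U t ω + (T * x) ^ 2 +
        2 * (U t ω * A ω)) μ := j2.add i3
    have hint := integral_mono (hUL2 (t + T)).integrable_sq (j3.add i4) hpt
    have e : ∫ ω, ((U t ω : ℝ) ^ 2 - 2 * (T * x) * U t ω + (T * x) ^ 2 +
        2 * (U t ω * A ω) + A ω ^ 2) ∂μ =
        ∫ ω, (U t ω : ℝ) ^ 2 ∂μ - 2 * (T * x) * ∫ ω, (U t ω : ℝ) ∂μ + (T * x) ^ 2 +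
          2 * ∫ ω, U t ω * A ω ∂μ + ∫ ω, A ω ^ 2 ∂μ := by
      rw [integral_add j3 i4, integral_add j2 i3, integral_add j1 (integrable_const _),
        integral_sub i1 i2, integral_const_mul, integral_const_mul]
      simp
    have h1 : ∫ ω, U t ω * A ω ∂μ ≤ T * (r f + δ) * ∫ ω, (U t ω : ℝ) ∂μ :=
      hwin (T₀ + 1) t (fun ω => (U t ω : ℝ)) (measurable_from_top.comp (hUm t))
        (fun ω => Nat.cast_nonneg _) (hUL2 t)
    have h2 : ∫ ω, A ω ^ 2 ∂μ ≤ C := hC t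
    have h3 : x = r f + 2 * δ := by rw [hδ]; ring
    have hint' := hint.trans_eq e
    have h4 : 2 * (T * x) * ∫ ω, (U t ω : ℝ) ∂μ =
        2 * (T * (r f + δ) * ∫ ω, (U t ω : ℝ) ∂μ) + 2 * T * δ * ∫ ω, (U t ω : ℝ) ∂μ := by
      rw [h3]; ring
    linarith
  have hsum := mul_sum_le_of_drift (fun t => integral_nonneg fun ω => sq_nonneg (U t ω : ℝ)) hdrift
  have hκ : 0 < 2 * T * δ := by positivity
  refine stronglyStable_of_sum_integral_le (fun t => (hUL2 t).integrable one_le_two)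
    (D := (∑ t ∈ Finset.range T, ∫ ω, (U t ω : ℝ) ^ 2 ∂μ) / (2 * T * δ))
    (C := ((T * x) ^ 2 + C) / (2 * T * δ)) fun n => ?_
  rw [← mul_div_assoc (n : ℝ), ← add_div, le_div_iff₀ hκ, mul_comm]
  exact hsum n

end IsArrivalStream

end TrafficPattern

end ArrivalStream

/-! ### Achievable rates and the imperfection ratio -/

namespace TrafficPattern

variable {K N : ℕ} {P : TrafficPattern K N}

/-- A stable set schedule that serves all subflows faster than their rates, together with innovative
packets over a prime field with more than `N` elements, keeps the virtual queues stable. -/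
theorem achievableWithSpeedup_of_mem_STAB {r : P.Flow → ℝ} (hr : ∀ f, 0 ≤ r f) {s : ℝ} (hs : 0 ≤ s)
    {y : P.Subflow → ℝ} (hy : y ∈ STAB P.enhancedConflictGraph)
    (hry : ∀ w : P.Subflow, r w.1 < s * y w) : P.AchievableWithSpeedup s r := by
  obtain ⟨σ, L, hL, hσ, hper, hcount⟩ :=
    exists_periodic_schedule hy (x := fun w => r w.1) (fun w => hr _) hs hry
  obtain ⟨p, hNp, hp⟩ := Nat.exists_infinite_primes (N + 1)
  have : Fact p.Prime := ⟨hp⟩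
  have hN : N < Nat.card (ZMod p) := by rw [Nat.card_zmod]; exact hNp
  refine ⟨hr, ZMod p, inferInstance, inferInstance, innovativeScheme (ZMod p) σ s, ?_⟩
  intro Ω _ μ _ a ha w
  have hL' : (0 : ℝ) < L := by exact_mod_cast hL
  obtain ⟨x, hrx, hxs⟩ := exists_between (α := ℝ)
    ((lt_div_iff₀' hL').2 (hcount w))
  refine ha.stronglyStable_of_service w.1 (B := cumulativeService σ s w) ((hr _).trans hrx.le) hrx
    (fun t => measurable_history_of_congr a fun b b' h =>
      virtualQueue_innovativeScheme_congr σ s h w)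
    (fun t ω => virtualQueue_le_sum _ s _ w t)
    (fun t ω => virtualQueue_succ_le hN hσ hs _ w t)
    (fun t t' h => Finset.sum_le_sum_of_subset (Finset.range_mono (Nat.floor_mono
      (mul_le_mul_of_nonneg_left (Nat.cast_le.2 h) hs)))) ?_
  exact exists_forall_le_cumulativeService hL hper hs ((lt_div_iff₀' hL').1 hxs)

theorem achievableWithSpeedup_smul {r : P.Flow → ℝ} (hr : r ∈ P.admissibleRegion) {c s : ℝ}
    (hc : 0 ≤ c) (hs : c * imperfectionRatio P.enhancedConflictGraph < s) :
    P.AchievableWithSpeedup s (c • r) := by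
  obtain ⟨y, hy, hlt⟩ := exists_mem_STAB_lt (P.rate_mem_QSTAB hr) hc hs
  exact achievableWithSpeedup_of_mem_STAB (fun f => mul_nonneg hc (hr.1 f))
    ((mul_nonneg hc (imperfectionRatio_nonneg _)).trans hs.le) hy hlt

variable (P)

theorem mem_sufficientSpeedups {s : ℝ} (hs : imperfectionRatio P.enhancedConflictGraph < s) :
    s ∈ P.sufficientSpeedups :=
  ⟨(imperfectionRatio_nonneg _).trans hs.le, fun r hr => by
    simpa using achievableWithSpeedup_smul hr zero_le_one (by simpa using hs)⟩

theorem inv_smul_mem_rateRegion {r : P.Flow → ℝ} (hr : r ∈ P.admissibleRegion) {s : ℝ}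
    (hs : imperfectionRatio P.enhancedConflictGraph < s) : s⁻¹ • r ∈ P.rateRegion := by
  have hs0 : 0 < s := (imperfectionRatio_nonneg _).trans_lt hs
  refine achievableWithSpeedup_smul hr (inv_nonneg.2 hs0.le) ?_
  rwa [inv_mul_lt_iff₀ hs0, mul_one]

theorem mem_sufficientScalings {s : ℝ} (hs : imperfectionRatio P.enhancedConflictGraph < s) :
    s ∈ P.sufficientScalings := by
  have hs0 : 0 < s := (imperfectionRatio_nonneg _).trans_lt hs
  exact ⟨hs0.le, fun r hr => ⟨s⁻¹ • r, P.inv_smul_mem_rateRegion hr hs, smul_inv_smul₀ hs0.ne' r⟩⟩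

/-- Let the scaling factors tend to the imperfection ratio. If the latter is `0`, then `QSTAB = {0}`
and there are no admissible rates but `0`. -/
theorem admissibleRegion_subset_smul_closure : P.admissibleRegion ⊆
    imperfectionRatio P.enhancedConflictGraph • closure P.rateRegion := by
  intro r hr
  rcases (imperfectionRatio_nonneg P.enhancedConflictGraph).eq_or_lt with h0 | h0
  · have hr0 : r = 0 := by
      funext f
      obtain ⟨j, hj⟩ := P.fanout_nonempty f.1 f.2
      obtain ⟨y, -, hy⟩ := (isLeast_imperfectionRatio P.enhancedConflictGraph).1.2
        (P.rate_mem_QSTAB hr)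
      rw [← h0] at hy
      simpa using (congrFun hy ⟨f, j, hj⟩).symm
    refine ⟨_, subset_closure (P.inv_smul_mem_rateRegion hr (lt_add_one _)), ?_⟩
    rw [← h0, hr0]
    simp
  · refine ⟨(imperfectionRatio P.enhancedConflictGraph)⁻¹ • r, ?_, smul_inv_smul₀ h0.ne' r⟩
    have hlim : Tendsto (fun s : ℝ => s⁻¹ • r) (𝓝[>] imperfectionRatio P.enhancedConflictGraph)
        (𝓝 ((imperfectionRatio P.enhancedConflictGraph)⁻¹ • r)) :=
      ((tendsto_inv₀ h0.ne').mono_left nhdsWithin_le_nhds).smul_const r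
    exact mem_closure_of_tendsto hlim (eventually_nhdsWithin_of_forall fun s hs =>
      P.inv_smul_mem_rateRegion hr hs)

end TrafficPattern

end MulticastSwitch

theorem mainTheorem1 {K N : ℕ} (P : MulticastSwitch.TrafficPattern K N) :
    IsLeast (MulticastSwitch.imperfectionDilations P.enhancedConflictGraph)
      (MulticastSwitch.imperfectionRatio P.enhancedConflictGraph) ∧
    (P.sufficientSpeedups.Nonempty ∧
      P.minSpeedup ≤ MulticastSwitch.imperfectionRatio P.enhancedConflictGraph) ∧
    (P.sufficientScalings.Nonempty ∧
      P.minScaling ≤ MulticastSwitch.imperfectionRatio P.enhancedConflictGraph) ∧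
    P.admissibleRegion ⊆
      MulticastSwitch.imperfectionRatio P.enhancedConflictGraph • closure P.rateRegion := by
  refine ⟨MulticastSwitch.isLeast_imperfectionRatio _,
    ⟨⟨_, P.mem_sufficientSpeedups (lt_add_one _)⟩, ?_⟩,
    ⟨⟨_, P.mem_sufficientScalings (lt_add_one _)⟩, ?_⟩, P.admissibleRegion_subset_smul_closure⟩
  · exact le_of_forall_gt_imp_ge_of_dense fun s hs =>
      csInf_le ⟨0, fun _ h => h.1⟩ (P.mem_sufficientSpeedups hs)
  · exact le_of_forall_gt_imp_ge_of_dense fun s hs =>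
      csInf_le ⟨0, fun _ h => h.1⟩ (P.mem_sufficientScalings hs)
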